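/- Let $d$ be a dimension, $\lambda$ Lebesgue measure on $\mathbb{R}^d$, and $(\Omega,\mathcal F)$ a measurable space with a measure $\mathbf P$, not necessarily finite. Let $X$ be a random element of a measurable space $E$ on which $\mathbb{R}^d$ acts by shifts $\theta_t$ with $(t,x)\mapsto\theta_t x$ measurable. Let $Z=(Z_s)_{s\in\mathbb{R}^d}$ be a $[0,\infty)$-valued random field that is shift-measurable: its paths lie in a shift-invariant set $H$ of functions $\mathbb{R}^d\to[0,\infty)$, equipped with the $\sigma$-algebra generated by the evaluations, such that $(t,z)\mapsto\theta_t z=(z_{t+s})_{s\in\mathbb{R}^d}$ is measurable on $\mathbb{R}^d\times H$. Let $\xi$ be a (locally finite) random measure on $\mathbb{R}^d$ with density field $Z$, that is, $\xi(ds)=Z_s\,ds$. Put $\theta_t\xi(B)=\xi(B+t)$, and let $\theta_t$ act coordinatewise on pairs. Suppose that the distribution of $((X,Z),\xi)$ under $\mathbf P$ is $\sigma$-finite and that $(X,Z)$ is stationary under $\mathbf P$, i.e. $\theta_t(X,Z)\overset{D}{=}(X,Z)$ under $\mathbf P$ for all $t\in\mathbb{R}^d$. Define a measure $\mathbf P^\circ$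 on $(\Omega,\mathcal F)$ by $d\mathbf P^\circ=Z_0\,d\mathbf P$. Then, writing $Y=((X,Z),\xi)$: (i) $Y$ under $\mathbf P^\circ$ is the Palm version of $Y$ under $\mathbf P$: the pair $Y$ is stationary under $\mathbf P$, its distribution is $\sigma$-finite under both $\mathbf P$ and $\mathbf P^\circ$, and for every measurable $f\ge 0$ and every Borel set $B\subseteq\mathbb{R}^d$ with $0<\lambda(B)<\infty$, $$\mathbf E^\circ[f(Y)]=\frac1{\lambda(B)}\,\mathbf E\Big[\int_B f(\theta_t Y)\,\xi(dt)\Big].$$ (ii) $Y$ is mass-stationary under $\mathbf P^\circ$: its distribution under $\mathbf P^\circ$ is $\sigma$-finite, $0$ lies in the support of $\xi$ $\mathbf P^\circ$-a.e., and for every bounded Borel set $C\subseteq\mathbb{R}^d$ with $\lambda(C)>0$ and $\lambda(\partial C)=0$, $$(\theta_{V_C}Y,\;V_C+U_C)\overset{D}{=}(Y,\;U_C)\quad\text{under }\mathbf P^\circ,$$ where, on an extension of $(\Omega,\mathcal F,\mathbf P^\circ)$, the conditional distribution of $U_C$ given $Y$ is uniform on $C$ and the conditional distribution of $V_C$ given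 $(Y,U_C)$ is $\xi(\,\cdot\mid C-U_C)$. -/

import Mathlib

open MeasureTheory ProbabilityTheory
open scoped NNReal ENNReal

/-- `ℝ^d` with its Borel σ-algebra and Lebesgue measure `volume`. -/
abbrev Rd (d : ℕ) : Type := EuclideanSpace ℝ (Fin d)

/-- The shift `θ_t μ (B) = μ (B + t)` of a measure on `ℝ^d`. -/
noncomputable def shiftMeasure {d : ℕ} (t : Rd d) (μ : Measure (Rd d)) : Measure (Rd d) :=
  μ.map (fun x => x - t)

/-- The joint shift `θ_t (x, μ) = (θ_t x, θ_t μ)`, where `θ_t x` is given by the action of `ℝ^d`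
on `E`. -/
noncomputable def shiftPair {d : ℕ} {E : Type*} [AddAction (Rd d) E] (t : Rd d)
    (y : E × Measure (Rd d)) : E × Measure (Rd d) :=
  (t +ᵥ y.1, shiftMeasure t y.2)

/-- A random measure on `ℝ^d`: a measurable map into the locally finite measures. -/
structure IsRandomMeasure {d : ℕ} {Ω : Type*} [MeasurableSpace Ω]
    (ξ : Ω → Measure (Rd d)) : Prop where
  measurable : Measurable ξ
  locallyFinite : ∀ ω, IsLocallyFiniteMeasure (ξ ω)

/-- A random element `Y` of a space on which `ℝ^d` acts is stationary under the measure `P` if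
`θ_t Y` and `Y` have the same distribution for every `t`. -/
def IsStationaryElement (d : ℕ) {Ω F : Type*} [MeasurableSpace Ω] [MeasurableSpace F]
    [AddAction (Rd d) F] (P : Measure Ω) (Y : Ω → F) : Prop :=
  ∀ t : Rd d, IdentDistrib (fun ω => t +ᵥ Y ω) Y P P

/-- Stationarity of a pair `(X, ξ)` under the measure `P`. -/
def IsStationaryPair {d : ℕ} {Ω E : Type*} [MeasurableSpace Ω] [MeasurableSpace E]
    [AddAction (Rd d) E] (P : Measure Ω) (X : Ω → E) (ξ : Ω → Measure (Rd d)) : Prop :=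
  ∀ t : Rd d, IdentDistrib (fun ω => shiftPair t (X ω, ξ ω)) (fun ω => (X ω, ξ ω)) P P

/-- The pair `(X', ξ')` under `P'` is the Palm version of the stationary pair `(X, ξ)` under `P`.
All distributions may be infinite, but are σ-finite. -/
structure IsPalmVersion {d : ℕ} {Ω' Ω E : Type*} [MeasurableSpace Ω'] [MeasurableSpace Ω]
    [MeasurableSpace E] [AddAction (Rd d) E]
    (P' : Measure Ω') (X' : Ω' → E) (ξ' : Ω' → Measure (Rd d))
    (P : Measure Ω) (X : Ω → E) (ξ : Ω → Measure (Rd d)) : Prop where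
  stationary : IsStationaryPair P X ξ
  sigmaFinite : SigmaFinite (P.map fun ω => (X ω, ξ ω))
  sigmaFinite' : SigmaFinite (P'.map fun ω => (X' ω, ξ' ω))
  palm_formula : ∀ f : E × Measure (Rd d) → ℝ≥0∞, Measurable f →
    ∀ B : Set (Rd d), MeasurableSet B → 0 < volume B → volume B < ∞ →
      ∫⁻ ω, f (X' ω, ξ' ω) ∂P' =
        (∫⁻ ω, ∫⁻ t in B, f (shiftPair t (X ω, ξ ω)) ∂(ξ ω) ∂P) / volume B

/-- Under the (possibly infinite) measure `P`, the conditional distribution of `U` given `Y` is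
`κ Y`. -/
def HasCondLaw {Ω β γ : Type*} [MeasurableSpace Ω] [MeasurableSpace β] [MeasurableSpace γ]
    (P : Measure Ω) (U : Ω → γ) (Y : Ω → β) (κ : β → Measure γ) : Prop :=
  ∀ f : β × γ → ℝ≥0∞, Measurable f →
    ∫⁻ ω, f (Y ω, U ω) ∂P = ∫⁻ ω, ∫⁻ u, f (Y ω, u) ∂(κ (Y ω)) ∂P

/-- `R` extends the measure `P` on `Ω` to `Ω × ℝ^d × ℝ^d`, whose last two coordinates `U`, `V`
are such that the conditional distribution of `U` given `(X, ξ)` is uniform on `C` and the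
conditional distribution of `V` given `((X, ξ), U)` is `ξ(· | C - U)`. -/
structure IsMassSampling {d : ℕ} {Ω E : Type*} [MeasurableSpace Ω] [MeasurableSpace E]
    (P : Measure Ω) (X : Ω → E) (ξ : Ω → Measure (Rd d)) (C : Set (Rd d))
    (R : Measure (Ω × Rd d × Rd d)) : Prop where
  map_fst : R.map Prod.fst = P
  condLaw_U : HasCondLaw R (fun w => w.2.1) (fun w => (X w.1, ξ w.1))
    (fun _ => cond volume C)
  condLaw_V : HasCondLaw R (fun w => w.2.2) (fun w => ((X w.1, ξ w.1), w.2.1))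
    (fun y => cond y.1.2 {v | v + y.2 ∈ C})

/-- Mass-stationarity of the pair `(X, ξ)` under the (possibly infinite) measure `P`. The joint
distribution of `((X, ξ), U, V)` is determined by the sampling rule, so the choice of the
extension is immaterial. -/
structure IsMassStationary {d : ℕ} {Ω E : Type*} [MeasurableSpace Ω] [MeasurableSpace E]
    [AddAction (Rd d) E] (P : Measure Ω) (X : Ω → E) (ξ : Ω → Measure (Rd d)) : Prop where
  sigmaFinite : SigmaFinite (P.map fun ω => (X ω, ξ ω))
  zero_mem_support : ∀ᵐ ω ∂P, (0 : Rd d) ∈ (ξ ω).support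
  identDistrib : ∀ C : Set (Rd d), MeasurableSet C → Bornology.IsBounded C → 0 < volume C →
    volume (frontier C) = 0 →
      (∃ R : Measure (Ω × Rd d × Rd d), IsMassSampling P X ξ C R) ∧
      ∀ R : Measure (Ω × Rd d × Rd d), IsMassSampling P X ξ C R →
        IdentDistrib
          (fun w => (shiftPair w.2.2 (X w.1, ξ w.1), w.2.2 + w.2.1))
          (fun w => ((X w.1, ξ w.1), w.2.1)) R R

/-- A path space for shift-measurable random fields with values in `[0, ∞)`: a shift-invariant
set of functions `ℝ^d → [0, ∞)` such that `(t, z) ↦ θ_t z`, `θ_t z = (z (t + s))_s`, is measurable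
for the σ-algebra generated by the evaluations `z ↦ z s`. -/
structure PathSpace (d : ℕ) where
  carrier : Set (Rd d → ℝ≥0)
  shift_mem : ∀ (t : Rd d) (z : carrier), (fun s => z.1 (t + s)) ∈ carrier
  measurable_shift :
    Measurable fun p : Rd d × carrier => (⟨fun s => p.2.1 (p.1 + s), shift_mem p.1 p.2⟩ : carrier)

/-- The shift `θ_t z = (z (t + s))_s` as an action of `ℝ^d` on a path space. -/
instance PathSpace.instAddAction {d : ℕ} (H : PathSpace d) : AddAction (Rd d) H.carrier where
  vadd t z := ⟨fun s => z.1 (t + s), H.shift_mem t z⟩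
  zero_vadd z := Subtype.ext (funext fun s => congrArg z.1 (zero_add s))
  add_vadd t u z := Subtype.ext (funext fun s => congrArg z.1 (by
    show t + u + s = u + (t + s)
    abel))

/-- The random field `Z`, with paths in a path space `H`, is a density field of `ξ`, that is,
`ξ(ds) = Z_s ds`. -/
structure IsDensityField {d : ℕ} {Ω : Type*} [MeasurableSpace Ω] {H : PathSpace d}
    (Z : Ω → H.carrier) (ξ : Ω → Measure (Rd d)) : Prop where
  measurable : Measurable Z
  eq_withDensity : ∀ ω, ξ ω = volume.withDensity (fun s => ((Z ω).1 s : ℝ≥0∞))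

/-! With `W = (X, Z)` and `ζ (x, z) = z 0`, the value of the field at `s` is `ζ (s +ᵥ W)`. So `ξ` is
an equivariant function of `W`, and the whole statement concerns a stationary element `W` and the
weight `ζ (W)`.

Palm formula: `∫_B f(θ_t Y) ξ(dt)` is the Lebesgue integral over `B` of `g (t +ᵥ W)` with `g = ζ ·
f`. By Tonelli and stationarity each `t` contributes the same amount, `E°[f(Y)]`. Applied to the
event that `0` is outside the support, it shows this event to be `P°`-null (`ae_zero_mem_support`).

Mass-stationarity: the joint law of `(W, U, V)` has an explicit density with respect to `P ⊗ du ⊗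
dv`, and that product is invariant under `(W, u, v) ↦ (θ_v W, v + u, v)` (`lintegral_vadd_add`). In
the moved variables, integrating out `v` produces exactly the window mass `ξ(C - u)`, which cancels
the normalising constant (`lintegral_window_shift`). Cancellation needs this mass finite (`C`
bounded) and nonzero (`0` in the support, `u` interior to `C`). -/

/-! ### Measures with an equivariant density field, and their windows -/

section FieldMeasure

variable {d : ℕ} {F : Type*} [MeasurableSpace F] [AddAction (Rd d) F]

/-- The measure on `ℝ^d` whose density at `s` is `ζ (s +ᵥ y)`. -/
noncomputable def fieldMeasure (ζ : F → ℝ≥0∞) (y : F) : Measure (Rd d) :=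
  volume.withDensity fun s => ζ (s +ᵥ y)

variable [MeasurableVAdd₂ (Rd d) F] {ζ : F → ℝ≥0∞}

theorem lintegral_fieldMeasure (hζ : Measurable ζ) (y : F) {g : Rd d → ℝ≥0∞}
    (hg : Measurable g) :
    ∫⁻ s, g s ∂(fieldMeasure ζ y) = ∫⁻ s : Rd d, ζ (s +ᵥ y) * g s :=
  lintegral_withDensity_eq_lintegral_mul _ (by fun_prop) hg

theorem fieldMeasure_apply (hζ : Measurable ζ) (y : F) {B : Set (Rd d)}
    (hB : MeasurableSet B) :
    fieldMeasure ζ y B = ∫⁻ s : Rd d, ζ (s +ᵥ y) * B.indicator 1 s := by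
  rw [← lintegral_fieldMeasure hζ y (measurable_one.indicator hB), lintegral_indicator_one hB]

theorem measurable_fieldMeasure (hζ : Measurable ζ) :
    Measurable (fieldMeasure ζ : F → Measure (Rd d)) := by
  refine Measure.measurable_of_measurable_coe _ fun B hB => ?_
  simp_rw [fieldMeasure_apply hζ _ hB]
  have h1 : Measurable (B.indicator (1 : Rd d → ℝ≥0∞)) := measurable_one.indicator hB
  exact Measurable.lintegral_prod_right'
    (f := fun p : F × Rd d => ζ (p.2 +ᵥ p.1) * B.indicator 1 p.2) (by fun_prop)

theorem shiftMeasure_fieldMeasure (hζ : Measurable ζ) (t : Rd d) (y : F) :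
    shiftMeasure t (fieldMeasure ζ y) = fieldMeasure ζ (t +ᵥ y) := by
  ext B hB
  have hm : Measurable fun x : Rd d => x - t := by fun_prop
  rw [shiftMeasure, Measure.map_apply hm hB, fieldMeasure_apply hζ _ (hm hB),
    fieldMeasure_apply hζ _ hB,
    ← lintegral_add_right_eq_self (fun s : Rd d => ζ (s +ᵥ y) * _) t]
  refine lintegral_congr fun s => ?_
  have hs : s + t ∈ (fun x => x - t) ⁻¹' B ↔ s ∈ B := by
    rw [Set.mem_preimage, add_sub_cancel_right]
  by_cases h : s ∈ B
  · rw [Set.indicator_of_mem h, Set.indicator_of_mem (hs.2 h), vadd_vadd]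
    rfl
  · rw [Set.indicator_of_notMem h, Set.indicator_of_notMem (hs.not.2 h), mul_zero, mul_zero]

theorem shiftPair_fieldMeasure (hζ : Measurable ζ) (t : Rd d) (y : F) :
    shiftPair t (y, fieldMeasure ζ y) = (t +ᵥ y, fieldMeasure ζ (t +ᵥ y)) := by
  rw [shiftPair, shiftMeasure_fieldMeasure hζ]

theorem measurableSet_add_mem {C : Set (Rd d)} (hC : MeasurableSet C) (u : Rd d) :
    MeasurableSet {v | v + u ∈ C} :=
  (measurable_add_const u) hC

theorem measurable_fieldMeasure_window (hζ : Measurable ζ) {C : Set (Rd d)}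
    (hC : MeasurableSet C) {α : Type*} [MeasurableSpace α] {a : α → F} {b : α → Rd d}
    (ha : Measurable a) (hb : Measurable b) :
    Measurable fun p => fieldMeasure ζ (a p) {v | v + b p ∈ C} := by
  simp_rw [fun p => fieldMeasure_apply hζ (a p) (measurableSet_add_mem hC (b p))]
  have h1 : Measurable (C.indicator (1 : Rd d → ℝ≥0∞)) := measurable_one.indicator hC
  exact Measurable.lintegral_prod_right'
    (f := fun p : α × Rd d => ζ (p.2 +ᵥ a p.1) * C.indicator 1 (p.2 + b p.1)) (by fun_prop)

/-- Since `C - (v + u) = (C - u) - v`, moving the origin to `v` and `u` to `v + u` leaves the window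
in place, so the normalising constant is unchanged. -/
theorem fieldMeasure_window_vadd (hζ : Measurable ζ) {C : Set (Rd d)}
    (hC : MeasurableSet C) (y : F) (u v : Rd d) :
    fieldMeasure ζ (v +ᵥ y) {w | w + (v + u) ∈ C} = fieldMeasure ζ y {w | w + u ∈ C} := by
  rw [← shiftMeasure_fieldMeasure hζ, shiftMeasure,
    Measure.map_apply (by fun_prop) (measurableSet_add_mem hC _)]
  congr 1
  ext w
  simp [← add_assoc]

/-- The density with respect to Lebesgue measure of the conditional distribution
`ξ(· | C - u)`, where `ξ` is the measure with density field `ζ`. -/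
noncomputable def windowDensity (ζ : F → ℝ≥0∞) (C : Set (Rd d)) (p : F × Rd d × Rd d) : ℝ≥0∞ :=
  (fieldMeasure ζ p.1 {v | v + p.2.1 ∈ C})⁻¹ *
    (ζ (p.2.2 +ᵥ p.1) * C.indicator 1 (p.2.2 + p.2.1))

theorem measurable_windowDensity (hζ : Measurable ζ) {C : Set (Rd d)} (hC : MeasurableSet C) :
    Measurable (windowDensity ζ C) := by
  have h1 : Measurable (C.indicator (1 : Rd d → ℝ≥0∞)) := measurable_one.indicator hC
  refine (measurable_fieldMeasure_window hζ hC measurable_fst (by fun_prop)).inv.mul ?_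
  fun_prop

/-- No condition on the window mass is needed: if it is `0`, the factor `∞` multiplies an a.e.
vanishing function, and if it is `∞`, both sides are `0`. -/
theorem lintegral_cond_fieldMeasure (hζ : Measurable ζ) {C : Set (Rd d)}
    (hC : MeasurableSet C) (y : F) (u : Rd d) {g : Rd d → ℝ≥0∞} (hg : Measurable g) :
    ∫⁻ v, g v ∂(cond (fieldMeasure ζ y) {v | v + u ∈ C}) =
      ∫⁻ v, windowDensity ζ C (y, u, v) * g v := by
  have h1 : Measurable (C.indicator (1 : Rd d → ℝ≥0∞)) := measurable_one.indicator hC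
  rw [ProbabilityTheory.cond, lintegral_smul_measure,
    ← lintegral_indicator (measurableSet_add_mem hC u),
    lintegral_fieldMeasure hζ y (hg.indicator (measurableSet_add_mem hC u)), smul_eq_mul,
    ← lintegral_const_mul]
  · refine lintegral_congr fun v => ?_
    by_cases hv : v + u ∈ C <;> simp [windowDensity, Set.indicator, hv, mul_assoc]
  · have := hg.indicator (measurableSet_add_mem hC u)
    fun_prop

/-- Passing to the density turns the varying conditional law into the fixed Lebesgue measure, with a
jointly measurable integrand. -/
theorem measurable_lintegral_cond_fieldMeasure (hζ : Measurable ζ) {C : Set (Rd d)}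
    (hC : MeasurableSet C) {g : F × Rd d × Rd d → ℝ≥0∞} (hg : Measurable g) :
    Measurable fun p : F × Rd d =>
      ∫⁻ v, g (p.1, p.2, v) ∂(cond (fieldMeasure ζ p.1) {v | v + p.2 ∈ C}) := by
  have h (p : F × Rd d) := lintegral_cond_fieldMeasure hζ hC p.1 p.2
    (hg.comp (by fun_prop : Measurable fun v : Rd d => (p.1, p.2, v)))
  simp only [Function.comp_def] at h
  simp_rw [h]
  have := measurable_windowDensity hζ hC
  exact Measurable.lintegral_prod_right' (f := fun p : (F × Rd d) × Rd d =>
    windowDensity ζ C (p.1.1, p.1.2, p.2) * g (p.1.1, p.1.2, p.2)) (by fun_prop)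

omit [MeasurableSpace F] [MeasurableVAdd₂ (Rd d) F] in
theorem fieldMeasure_window_ne_top {y : F}
    [IsLocallyFiniteMeasure (fieldMeasure ζ y : Measure (Rd d))] {C : Set (Rd d)}
    (hb : Bornology.IsBounded C) (u : Rd d) :
    fieldMeasure ζ y {v | v + u ∈ C} ≠ ∞ := by
  have : Bornology.IsBounded {v | v + u ∈ C} := by
    refine (hb.sub (Bornology.isBounded_singleton (x := u))).subset fun v hv => ?_
    exact ⟨v + u, hv, u, rfl, by simp⟩
  exact this.measure_lt_top.ne

/-- For `u` interior to `C`, the window `C - u` is a neighbourhood of `0`. -/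
theorem measure_window_ne_zero {μ : Measure (Rd d)} (h : (0 : Rd d) ∈ μ.support)
    {C : Set (Rd d)} {u : Rd d} (hu : u ∈ interior C) : μ {v | v + u ∈ C} ≠ 0 := by
  refine ((Measure.mem_support_iff_forall _).1 h _ ?_).ne'
  have hc : ContinuousAt (fun v : Rd d => v + u) 0 := by fun_prop
  exact hc (by simpa [zero_add] using mem_interior_iff_mem_nhds.1 hu)

theorem ae_cond_mem_interior {C : Set (Rd d)} (hC : MeasurableSet C)
    (h : volume (frontier C) = 0) : ∀ᵐ u ∂(cond volume C), u ∈ interior C := by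
  have hf := (cond_absolutelyContinuous (μ := volume) (s := C)).ae_le
    (measure_eq_zero_iff_ae_notMem.1 h)
  filter_upwards [hf, ae_cond_mem hC] with u hf hu
  by_contra hi
  exact hf ⟨subset_closure hu, hi⟩

end FieldMeasure

/-! ### The origin in the support of a measure -/

section Support

variable {d : ℕ}

theorem measurableSet_zero_mem_support :
    MeasurableSet {μ : Measure (Rd d) | (0 : Rd d) ∈ μ.support} := by
  -- A countable basis of balls reduces the claim to countably many evaluations.
  simp_rw [Metric.nhds_basis_ball_inv_nat_succ.mem_measureSupport, true_imp_iff, Set.ofPred_forall]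
  exact MeasurableSet.iInter fun n =>
    measurableSet_lt measurable_const (Measure.measurable_coe Metric.isOpen_ball.measurableSet)

theorem zero_mem_support_shiftMeasure (t : Rd d) (μ : Measure (Rd d)) :
    (0 : Rd d) ∈ (shiftMeasure t μ).support ↔ t ∈ μ.support := by
  have (r : ℝ) : shiftMeasure t μ (Metric.ball 0 r) = μ (Metric.ball t r) := by
    rw [shiftMeasure, Measure.map_apply (by fun_prop) Metric.isOpen_ball.measurableSet]
    congr 1
    ext x
    simp [dist_eq_norm]
  simp_rw [Metric.nhds_basis_ball.mem_measureSupport, this]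

end Support

/-! ### Consequences of stationarity: Palm formula and joint shift invariance -/

section Stationary

variable {d : ℕ} {Ω F : Type*} [MeasurableSpace Ω] [MeasurableSpace F] [AddAction (Rd d) F]
  [MeasurableVAdd₂ (Rd d) F] {P : Measure Ω} {W : Ω → F} {ζ : F → ℝ≥0∞}

theorem IsStationaryElement.lintegral_vadd (hstat : IsStationaryElement d P W) (hW : Measurable W)
    (t : Rd d) {g : F → ℝ≥0∞} (hg : Measurable g) :
    ∫⁻ ω, g (t +ᵥ W ω) ∂P = ∫⁻ ω, g (W ω) ∂P := by
  have := (hstat t).map_eq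
  rw [← lintegral_map hg hW, ← this, lintegral_map hg (by fun_prop)]

theorem lintegral_withDensity_comp (hζ : Measurable ζ) (hW : Measurable W) {g : Ω → ℝ≥0∞}
    (hg : Measurable g) :
    ∫⁻ ω, g ω ∂(P.withDensity fun ω => ζ (W ω)) = ∫⁻ ω, ζ (W ω) * g ω ∂P :=
  lintegral_withDensity_eq_lintegral_mul _ (hζ.comp hW) hg

theorem IsStationaryElement.palm_formula [SFinite P] (hstat : IsStationaryElement d P W)
    (hζ : Measurable ζ) (hW : Measurable W)
    {f : F × Measure (Rd d) → ℝ≥0∞} (hf : Measurable f) {B : Set (Rd d)} (hB : MeasurableSet B) :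
    ∫⁻ ω, ∫⁻ t in B, f (shiftPair t (W ω, fieldMeasure ζ (W ω))) ∂(fieldMeasure ζ (W ω)) ∂P =
      volume B * ∫⁻ ω, f (W ω, fieldMeasure ζ (W ω)) ∂(P.withDensity fun ω => ζ (W ω)) := by
  have hm := measurable_fieldMeasure (d := d) hζ
  set g : F → ℝ≥0∞ := fun y => ζ y * f (y, fieldMeasure ζ y) with hg
  have hgm : Measurable g := by fun_prop
  have inner (y : F) : ∫⁻ t in B, f (shiftPair t (y, fieldMeasure ζ y)) ∂(fieldMeasure ζ y) =
      ∫⁻ t in B, g (t +ᵥ y) := by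
    simp_rw [shiftPair_fieldMeasure hζ]
    rw [← lintegral_indicator hB, lintegral_fieldMeasure hζ, ← lintegral_indicator hB]
    · refine lintegral_congr fun t => ?_
      by_cases ht : t ∈ B <;> simp [ht, hg]
    · exact Measurable.indicator (by fun_prop) hB
  simp_rw [inner]
  rw [lintegral_lintegral_swap (by unfold Function.uncurry; fun_prop),
    lintegral_withDensity_comp hζ hW (by fun_prop)]
  simp_rw [hstat.lintegral_vadd hW _ hgm]
  rw [setLIntegral_const, mul_comm]

/-- The origin is outside the support of `θ_t ξ` exactly when `t` is outside that of `ξ`, and `ξ`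
does not charge such `t`; the Palm formula carries this over to `P°`. -/
theorem IsStationaryElement.ae_zero_mem_support [SFinite P] (hstat : IsStationaryElement d P W)
    (hζ : Measurable ζ) (hW : Measurable W) :
    ∀ᵐ ω ∂(P.withDensity fun ω => ζ (W ω)),
      (0 : Rd d) ∈ (fieldMeasure ζ (W ω) : Measure (Rd d)).support := by
  have hm := measurable_fieldMeasure (d := d) hζ
  let S : Set (F × Measure (Rd d)) := {p | (0 : Rd d) ∈ p.2.support}ᶜ
  have hS : MeasurableSet S := (measurable_snd measurableSet_zero_mem_support).compl
  -- The unit ball serves only as a set of positive volume.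
  have h := hstat.palm_formula hζ hW (measurable_one.indicator hS)
    (Metric.isOpen_ball (x := (0 : Rd d)) (ε := 1)).measurableSet
  have h0 : ∀ ω, ∫⁻ t in Metric.ball (0 : Rd d) 1,
      S.indicator 1 (shiftPair t (W ω, fieldMeasure ζ (W ω))) ∂(fieldMeasure ζ (W ω)) = 0 := by
    intro ω
    refine (lintegral_congr_ae (ae_restrict_of_ae ?_)).trans lintegral_zero
    filter_upwards [Measure.support_mem_ae (μ := (fieldMeasure ζ (W ω) : Measure (Rd d)))] with t ht
    refine Set.indicator_of_notMem ?_ _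
    simpa [S, shiftPair, zero_mem_support_shiftMeasure] using ht
  simp_rw [h0, lintegral_zero] at h
  have h1 := (mul_eq_zero.1 h.symm).resolve_left (Metric.measure_ball_pos volume _ one_pos).ne'
  have hmW : Measurable fun ω => (W ω, (fieldMeasure ζ (W ω) : Measure (Rd d))) := by fun_prop
  rw [lintegral_eq_zero_iff (by exact (measurable_one.indicator hS).comp hmW)] at h1
  filter_upwards [h1] with ω hω
  by_contra hc
  have : (W ω, (fieldMeasure ζ (W ω) : Measure (Rd d))) ∈ S := hc
  simp [this] at hω

/-- For fixed `v`, translation invariance of `du` removes the shift of `u` and stationarity removes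
that of `W`; hence `v` is made the outermost variable. -/
theorem IsStationaryElement.lintegral_vadd_add [SFinite P] (hstat : IsStationaryElement d P W)
    (hW : Measurable W) {B : F × Rd d × Rd d → ℝ≥0∞} (hB : Measurable B) :
    ∫⁻ ω, (∫⁻ u, ∫⁻ v, B (v +ᵥ W ω, v + u, v)) ∂P = ∫⁻ ω, (∫⁻ u, ∫⁻ v, B (W ω, u, v)) ∂P := by
  have swap (A : F × Rd d × Rd d → ℝ≥0∞) (hA : Measurable A) :
      ∫⁻ ω, (∫⁻ u, ∫⁻ v, A (W ω, u, v)) ∂P = ∫⁻ v, ∫⁻ ω, (∫⁻ u, A (W ω, u, v)) ∂P := by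
    have (y : F) : ∫⁻ u, ∫⁻ v, A (y, u, v) = ∫⁻ v, ∫⁻ u, A (y, u, v) :=
      lintegral_lintegral_swap (by unfold Function.uncurry; fun_prop)
    simp_rw [this]
    refine lintegral_lintegral_swap ?_
    exact (Measurable.lintegral_prod_right' (f := fun p : (Ω × Rd d) × Rd d =>
      A (W p.1.1, p.2, p.1.2)) (by fun_prop)).aemeasurable
  rw [swap (fun p => B (p.2.2 +ᵥ p.1, p.2.2 + p.2.1, p.2.2)) (by fun_prop), swap B hB]
  refine lintegral_congr fun v => ?_
  have (y : F) : ∫⁻ u, B (v +ᵥ y, v + u, v) = ∫⁻ u, B (v +ᵥ y, u, v) :=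
    lintegral_add_left_eq_self (fun u => B (v +ᵥ y, u, v)) v
  simp_rw [this]
  exact hstat.lintegral_vadd hW v (g := fun y => ∫⁻ u, B (y, u, v))
    (Measurable.lintegral_prod_right' (f := fun p : F × Rd d => B (p.1, p.2, v)) (by fun_prop))

/-! ### Change of variables for mass-stationarity -/

theorem IsStationaryElement.ae_window_ne_zero [SFinite P] (hstat : IsStationaryElement d P W)
    (hζ : Measurable ζ) (hW : Measurable W) {C : Set (Rd d)} (hC : MeasurableSet C)
    (hfr : volume (frontier C) = 0) :
    ∀ᵐ ω ∂(P.withDensity fun ω => ζ (W ω)), ∀ᵐ u ∂(cond volume C),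
      fieldMeasure ζ (W ω) {v | v + u ∈ C} ≠ 0 := by
  filter_upwards [hstat.ae_zero_mem_support hζ hW] with ω hω
  filter_upwards [ae_cond_mem_interior hC hfr] with u hu
  exact measure_window_ne_zero hω hu

theorem lintegral_cond_volume {C : Set (Rd d)} (hC : MeasurableSet C) (g : Rd d → ℝ≥0∞) :
    ∫⁻ u, g u ∂(cond volume C) = (volume C)⁻¹ * ∫⁻ u, C.indicator g u := by
  rw [ProbabilityTheory.cond, lintegral_smul_measure, smul_eq_mul, lintegral_indicator hC]

/-- The change of variables behind mass-stationarity: under the sampling rule, moving the origin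
to `V` and `U` to `V + U` does not change the joint distribution. -/
theorem IsStationaryElement.lintegral_window_shift [SFinite P] (hstat : IsStationaryElement d P W)
    (hζ : Measurable ζ) (hW : Measurable W)
    (hloc : ∀ ω, IsLocallyFiniteMeasure (fieldMeasure ζ (W ω) : Measure (Rd d)))
    {C : Set (Rd d)} (hC : MeasurableSet C) (hb : Bornology.IsBounded C)
    (hfr : volume (frontier C) = 0) {f : F × Rd d → ℝ≥0∞} (hf : Measurable f) :
    ∫⁻ ω, ∫⁻ u, ∫⁻ v, f (v +ᵥ W ω, v + u) ∂(cond (fieldMeasure ζ (W ω)) {v | v + u ∈ C})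
        ∂(cond volume C) ∂(P.withDensity fun ω => ζ (W ω)) =
      ∫⁻ ω, ∫⁻ u, f (W ω, u) ∂(cond volume C) ∂(P.withDensity fun ω => ζ (W ω)) := by
  have hχ : Measurable (C.indicator (1 : Rd d → ℝ≥0∞)) := measurable_one.indicator hC
  have hwin : Measurable fun p : F × Rd d × Rd d => fieldMeasure ζ p.1 {v | v + p.2.1 ∈ C} :=
    measurable_fieldMeasure_window hζ hC measurable_fst (by fun_prop)
  have hwd := measurable_windowDensity hζ hC
  have hcP : SFinite (cond (volume : Measure (Rd d)) C) := by
    unfold ProbabilityTheory.cond; infer_instance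
  -- `B` is the left-hand integrand in the moved variables, up to the factor `(volume C)⁻¹`: the
  -- original point and `u` are recovered by shifting back by `v`.
  let B : F × Rd d × Rd d → ℝ≥0∞ := fun p =>
    (C.indicator 1 p.2.1 * (fieldMeasure ζ p.1 {v | v + p.2.1 ∈ C})⁻¹ * ζ p.1 * f (p.1, p.2.1)) *
      (ζ (-p.2.2 +ᵥ p.1) * C.indicator 1 (-p.2.2 + p.2.1))
  have hBm : Measurable B := by fun_prop
  have key := hstat.lintegral_vadd_add hW hBm
  have hBsub (y : F) (u v : Rd d) : B (v +ᵥ y, v + u, v) =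
      ζ y * (C.indicator 1 u * (windowDensity ζ C (y, u, v) * f (v +ᵥ y, v + u))) := by
    simp only [B, windowDensity, fieldMeasure_window_vadd hζ hC, neg_vadd_vadd, neg_add_cancel_left]
    ring
  have hBint (y : F) (u : Rd d) : ∫⁻ v, B (y, u, v) =
      (C.indicator 1 u * (fieldMeasure ζ y {v | v + u ∈ C})⁻¹ * ζ y * f (y, u)) *
        fieldMeasure ζ y {v | v + u ∈ C} := by
    change ∫⁻ v : Rd d, (C.indicator 1 u * (fieldMeasure ζ y {v | v + u ∈ C})⁻¹ * ζ y * f (y, u)) *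
      (ζ (-v +ᵥ y) * C.indicator 1 (-v + u)) = _
    rw [lintegral_const_mul _ (by fun_prop)]
    congr 1
    rw [fieldMeasure_apply hζ y (measurableSet_add_mem hC u)]
    -- The reflection `v ↦ -v` turns the integral into the window mass.
    exact lintegral_neg_eq_self (fun v : Rd d => ζ (v +ᵥ y) * C.indicator 1 (v + u))
  have hshift : ∀ p : F × Rd d, ∫⁻ v, f (v +ᵥ p.1, v + p.2)
      ∂(cond (fieldMeasure ζ p.1) {v | v + p.2 ∈ C}) =
      ∫⁻ v, windowDensity ζ C (p.1, p.2, v) * f (v +ᵥ p.1, v + p.2) := fun p =>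
    lintegral_cond_fieldMeasure hζ hC p.1 p.2 (by fun_prop)
  have hinner : Measurable fun p : F × Rd d =>
      ∫⁻ v, windowDensity ζ C (p.1, p.2, v) * f (v +ᵥ p.1, v + p.2) :=
    Measurable.lintegral_prod_right' (f := fun p : (F × Rd d) × Rd d =>
      windowDensity ζ C (p.1.1, p.1.2, p.2) * f (p.2 +ᵥ p.1.1, p.2 + p.1.2)) (by fun_prop)
  have hL : ∫⁻ ω, ∫⁻ u, ∫⁻ v, f (v +ᵥ W ω, v + u)
        ∂(cond (fieldMeasure ζ (W ω)) {v | v + u ∈ C})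
        ∂(cond volume C) ∂(P.withDensity fun ω => ζ (W ω)) =
      (volume C)⁻¹ * ∫⁻ ω, (∫⁻ u, ∫⁻ v, B (v +ᵥ W ω, v + u, v)) ∂P := by
    simp_rw [fun ω u => hshift (W ω, u), hBsub]
    rw [lintegral_withDensity_comp hζ hW, ← lintegral_const_mul]
    · refine lintegral_congr fun ω => ?_
      rw [lintegral_cond_volume hC, mul_left_comm, ← lintegral_const_mul]
      · congr 1
        refine lintegral_congr fun u => ?_
        rw [lintegral_const_mul _ (by fun_prop), lintegral_const_mul _ (by fun_prop)]
        by_cases hu : u ∈ C <;> simp [hu]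
      · exact (hinner.comp (by fun_prop : Measurable fun u => (W ω, u))).indicator hC
    · refine Measurable.lintegral_prod_right' (f := fun p : Ω × Rd d => ∫⁻ v, ζ (W p.1) *
        (C.indicator 1 p.2 * (windowDensity ζ C (W p.1, p.2, v) * f (v +ᵥ W p.1, v + p.2)))) ?_
      exact Measurable.lintegral_prod_right' (f := fun p : (Ω × Rd d) × Rd d => ζ (W p.1.1) *
        (C.indicator 1 p.1.2 * (windowDensity ζ C (W p.1.1, p.1.2, p.2) *
          f (p.2 +ᵥ W p.1.1, p.2 + p.1.2)))) (by fun_prop)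
    · exact Measurable.lintegral_prod_right' (hinner.comp
        (by fun_prop : Measurable fun p : Ω × Rd d => (W p.1, p.2)))
  have hwin' : Measurable fun p : Ω × Rd d => fieldMeasure ζ (W p.1) {v | v + p.2 ∈ C} :=
    measurable_fieldMeasure_window hζ hC (by fun_prop) measurable_snd
  have hR : ∫⁻ ω, ∫⁻ u, f (W ω, u) ∂(cond volume C) ∂(P.withDensity fun ω => ζ (W ω)) =
      (volume C)⁻¹ * ∫⁻ ω, (∫⁻ u, ∫⁻ v, B (W ω, u, v)) ∂P := by
    simp_rw [hBint]
    have hae := hstat.ae_window_ne_zero hζ hW hC hfr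
    rw [ae_withDensity_iff (by fun_prop)] at hae
    rw [lintegral_withDensity_comp hζ hW, ← lintegral_const_mul]
    · refine lintegral_congr_ae ?_
      filter_upwards [hae] with ω hω
      -- The window masses are controlled only `P°`-a.e.; where the weight vanishes, both sides are
      -- `0`.
      rcases eq_or_ne (ζ (W ω)) 0 with h0 | h0
      · simp [h0]
      have := hloc ω
      rw [← lintegral_const_mul _ (by fun_prop)]
      trans ∫⁻ u, (fieldMeasure ζ (W ω) {v | v + u ∈ C})⁻¹ * ζ (W ω) * f (W ω, u) *
        fieldMeasure ζ (W ω) {v | v + u ∈ C} ∂(cond volume C)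
      · refine lintegral_congr_ae ?_
        filter_upwards [hω h0] with u hu
        rw [mul_right_comm, mul_right_comm _ (ζ (W ω)),
          ENNReal.inv_mul_cancel hu (fieldMeasure_window_ne_top hb u), one_mul]
      · rw [lintegral_cond_volume hC]
        congr 1
        refine lintegral_congr fun u => ?_
        by_cases hu : u ∈ C <;> simp [hu]
    · exact Measurable.lintegral_prod_right' (f := fun p : Ω × Rd d =>
        C.indicator 1 p.2 * (fieldMeasure ζ (W p.1) {v | v + p.2 ∈ C})⁻¹ * ζ (W p.1) *
          f (W p.1, p.2) * fieldMeasure ζ (W p.1) {v | v + p.2 ∈ C}) (by fun_prop)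
    · exact Measurable.lintegral_prod_right' (f := fun p : Ω × Rd d => f (W p.1, p.2))
        (by fun_prop)
  rw [hL, key, hR]

/-! ### The sampling rule: determination of the joint law and existence -/

theorem IsMassSampling.lintegral_eq {C : Set (Rd d)} (hC : MeasurableSet C)
    (hζ : Measurable ζ) (hW : Measurable W) {P₀ : Measure Ω} {Q : Measure (Ω × Rd d × Rd d)}
    (hQ : IsMassSampling P₀ W (fun ω => fieldMeasure ζ (W ω)) C Q)
    {f : F × Rd d × Rd d → ℝ≥0∞} (hf : Measurable f) :
    ∫⁻ w, f (W w.1, w.2.1, w.2.2) ∂Q =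
      ∫⁻ ω, ∫⁻ u, ∫⁻ v, f (W ω, u, v) ∂(cond (fieldMeasure ζ (W ω)) {v | v + u ∈ C})
        ∂(cond volume C) ∂P₀ := by
  have hcP : SFinite (cond (volume : Measure (Rd d)) C) := by
    unfold ProbabilityTheory.cond; infer_instance
  have hk := measurable_lintegral_cond_fieldMeasure hζ hC hf
  have hk' : Measurable fun y : F => ∫⁻ u, ∫⁻ v, f (y, u, v)
      ∂(cond (fieldMeasure ζ y) {v | v + u ∈ C}) ∂(cond volume C) :=
    Measurable.lintegral_prod_right' hk
  have hfst : Measurable fun p : (F × Measure (Rd d)) × Rd d => (p.1.1, p.2) := by fun_prop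
  have hV := hQ.condLaw_V (fun p => f (p.1.1.1, p.1.2, p.2)) (by fun_prop)
  have hU := hQ.condLaw_U _ (hk.comp hfst)
  simp only [Function.comp_def] at hU
  have hfst' := lintegral_map (μ := Q) (hk'.comp hW) measurable_fst
  simp only [Function.comp_def] at hfst'
  rw [hV, hU, ← hQ.map_fst, hfst']

theorem IsMassSampling.lintegral_eq_fst {E : Type*} [MeasurableSpace E] {X : Ω → E}
    {ξ : Ω → Measure (Rd d)} (hX : Measurable X) (hξ : Measurable ξ) {C : Set (Rd d)}
    {P₀ : Measure Ω} {Q : Measure (Ω × Rd d × Rd d)} (hQ : IsMassSampling P₀ X ξ C Q)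
    {f : (E × Measure (Rd d)) × Rd d → ℝ≥0∞} (hf : Measurable f) :
    ∫⁻ w, f ((X w.1, ξ w.1), w.2.1) ∂Q =
      ∫⁻ ω, ∫⁻ u, f ((X ω, ξ ω), u) ∂(cond volume C) ∂P₀ := by
  have hcP : SFinite (cond (volume : Measure (Rd d)) C) := by
    unfold ProbabilityTheory.cond; infer_instance
  rw [hQ.condLaw_U f hf, ← hQ.map_fst, lintegral_map _ measurable_fst]
  exact Measurable.lintegral_prod_right' (f := fun p : Ω × Rd d => f ((X p.1, ξ p.1), p.2))
    (by fun_prop)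

/-- Existence of an extension carrying the pair `(U, V)` of the sampling rule. -/
theorem exists_isMassSampling {C : Set (Rd d)} (hC : MeasurableSet C)
    (hb : Bornology.IsBounded C) (hpos : 0 < volume C)
    (hζ : Measurable ζ) (hW : Measurable W)
    (hloc : ∀ ω, IsLocallyFiniteMeasure (fieldMeasure ζ (W ω) : Measure (Rd d)))
    (P₀ : Measure Ω) [SFinite P₀]
    (hne : ∀ᵐ ω ∂P₀, ∀ᵐ u ∂(cond volume C), fieldMeasure ζ (W ω) {v | v + u ∈ C} ≠ 0) :
    ∃ Q : Measure (Ω × Rd d × Rd d),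
      IsMassSampling P₀ W (fun ω => fieldMeasure ζ (W ω)) C Q := by
  have hcP : IsProbabilityMeasure (cond (volume : Measure (Rd d)) C) :=
    cond_isProbabilityMeasure_of_finite hpos.ne' hb.measure_lt_top.ne
  have hm := measurable_fieldMeasure (d := d) hζ
  have hwd := measurable_windowDensity hζ hC
  let D : Ω × Rd d × Rd d → ℝ≥0∞ := fun w => windowDensity ζ C (W w.1, w.2.1, w.2.2)
  have hD : Measurable D := by fun_prop
  let Q : Measure (Ω × Rd d × Rd d) :=
    (P₀.prod ((cond volume C).prod volume)).withDensity D
  have hQ {g : Ω × Rd d × Rd d → ℝ≥0∞} (hg : Measurable g) : ∫⁻ w, g w ∂Q =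
      ∫⁻ ω, ∫⁻ u, ∫⁻ v, g (ω, u, v) ∂(cond (fieldMeasure ζ (W ω)) {v | v + u ∈ C})
        ∂(cond volume C) ∂P₀ := by
    rw [lintegral_withDensity_eq_lintegral_mul _ hD hg, lintegral_prod _ (by fun_prop)]
    refine lintegral_congr fun ω => ?_
    rw [lintegral_prod _ (by fun_prop)]
    refine lintegral_congr fun u => ?_
    rw [lintegral_cond_fieldMeasure hζ hC (W ω) u (by fun_prop)]
    rfl
  -- Integrating out `V` leaves no factor because the conditional law is a probability measure for
  -- almost every `(ω, u)`; this is where `hne` enters.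
  have hQ' {g : Ω × Rd d → ℝ≥0∞} (hg : Measurable g) : ∫⁻ w, g (w.1, w.2.1) ∂Q =
      ∫⁻ ω, ∫⁻ u, g (ω, u) ∂(cond volume C) ∂P₀ := by
    rw [hQ (g := fun w => g (w.1, w.2.1)) (by fun_prop)]
    refine lintegral_congr_ae ?_
    filter_upwards [hne] with ω hω
    refine lintegral_congr_ae ?_
    filter_upwards [hω] with u hu
    have := hloc ω
    have := cond_isProbabilityMeasure_of_finite hu (fieldMeasure_window_ne_top hb u)
    simp
  refine ⟨Q, ?_, ?_, ?_⟩
  · refine Measure.ext_of_lintegral _ fun g hg => ?_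
    rw [lintegral_map hg measurable_fst, hQ' (g := fun p => g p.1) (by fun_prop)]
    simp
  · intro f hf
    have hcf : Measurable fun y : F × Measure (Rd d) => ∫⁻ u, f (y, u) ∂(cond volume C) :=
      hf.lintegral_prod_right'
    rw [hQ' (g := fun p => f ((W p.1, fieldMeasure ζ (W p.1)), p.2)) (by fun_prop),
      hQ' (g := fun p => ∫⁻ u, f ((W p.1, fieldMeasure ζ (W p.1)), u) ∂(cond volume C))
        (by fun_prop)]
    simp
  · intro f hf
    have hk := measurable_lintegral_cond_fieldMeasure hζ hC
      (g := fun p => f (((p.1, fieldMeasure ζ p.1), p.2.1), p.2.2)) (by fun_prop)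
    rw [hQ (g := fun p => f (((W p.1, fieldMeasure ζ (W p.1)), p.2.1), p.2.2)) (by fun_prop)]
    exact (hQ' (hk.comp (by fun_prop : Measurable fun p : Ω × Rd d => (W p.1, p.2)))).symm

/-! ### Palm version and mass-stationarity for a general stationary element -/

theorem IsStationaryElement.isPalmVersion (hstat : IsStationaryElement d P W)
    (hζ : Measurable ζ) (hζ' : ∀ y, ζ y ≠ ∞) (hW : Measurable W)
    (hσ : SigmaFinite (P.map fun ω => (W ω, (fieldMeasure ζ (W ω) : Measure (Rd d))))) :
    IsPalmVersion (P.withDensity fun ω => ζ (W ω)) W (fun ω => fieldMeasure ζ (W ω))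
      P W (fun ω => (fieldMeasure ζ (W ω) : Measure (Rd d))) := by
  have hm := measurable_fieldMeasure (d := d) hζ
  have hmW : Measurable fun ω => (W ω, (fieldMeasure ζ (W ω) : Measure (Rd d))) := by fun_prop
  have hP : SigmaFinite P := SigmaFinite.of_map P hmW.aemeasurable hσ
  refine ⟨fun t => ?_, hσ, ?_, fun f hf B hB h0 htop => ?_⟩
  · simp_rw [shiftPair_fieldMeasure hζ]
    exact (hstat t).comp
      (by fun_prop : Measurable fun y => (y, (fieldMeasure ζ y : Measure (Rd d))))
  -- The weight depends on `ω` only through `W`, so the law under `P°` has a finite density with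
  -- respect to the σ-finite law under `P`.
  · have : (P.withDensity fun ω => ζ (W ω)).map
        (fun ω => (W ω, (fieldMeasure ζ (W ω) : Measure (Rd d)))) =
        (P.map fun ω => (W ω, (fieldMeasure ζ (W ω) : Measure (Rd d)))).withDensity
          fun p => ζ p.1 := by
      refine Measure.ext_of_lintegral _ fun g hg => ?_
      rw [lintegral_map hg hmW, lintegral_withDensity_comp hζ hW (by fun_prop),
        lintegral_withDensity_eq_lintegral_mul _ (by fun_prop) hg,
        lintegral_map (by fun_prop) hmW]
      rfl
    rw [this]
    exact SigmaFinite.withDensity_of_ne_top (ae_of_all _ fun p => hζ' p.1)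
  · rw [hstat.palm_formula hζ hW hf hB, mul_comm,
      ENNReal.mul_div_cancel_right h0.ne' htop.ne]

theorem IsStationaryElement.isMassStationary (hstat : IsStationaryElement d P W)
    (hζ : Measurable ζ) (hζ' : ∀ y, ζ y ≠ ∞) (hW : Measurable W)
    (hloc : ∀ ω, IsLocallyFiniteMeasure (fieldMeasure ζ (W ω) : Measure (Rd d)))
    (hσ : SigmaFinite (P.map fun ω => (W ω, (fieldMeasure ζ (W ω) : Measure (Rd d))))) :
    IsMassStationary (P.withDensity fun ω => ζ (W ω)) W
      (fun ω => (fieldMeasure ζ (W ω) : Measure (Rd d))) := by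
  have hm := measurable_fieldMeasure (d := d) hζ
  have hmW : Measurable fun ω => (W ω, (fieldMeasure ζ (W ω) : Measure (Rd d))) := by fun_prop
  have hP : SigmaFinite P := SigmaFinite.of_map P hmW.aemeasurable hσ
  refine ⟨(hstat.isPalmVersion hζ hζ' hW hσ).sigmaFinite', hstat.ae_zero_mem_support hζ hW,
    fun C hC hb hpos hfr => ⟨?_, fun Q hQ => ?_⟩⟩
  · exact exists_isMassSampling hC hb hpos hζ hW hloc _ (hstat.ae_window_ne_zero hζ hW hC hfr)
  · simp_rw [shiftPair_fieldMeasure hζ]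
    have h1 : Measurable fun w : Ω × Rd d × Rd d =>
        ((w.2.2 +ᵥ W w.1, (fieldMeasure ζ (w.2.2 +ᵥ W w.1) : Measure (Rd d))),
          w.2.2 + w.2.1) := by fun_prop
    have h2 : Measurable fun w : Ω × Rd d × Rd d =>
        ((W w.1, (fieldMeasure ζ (W w.1) : Measure (Rd d))), w.2.1) := by fun_prop
    refine ⟨h1.aemeasurable, h2.aemeasurable, Measure.ext_of_lintegral _ fun g hg => ?_⟩
    rw [lintegral_map hg h1, lintegral_map hg h2, hQ.lintegral_eq_fst hW (by fun_prop) hg,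
      hQ.lintegral_eq hC hζ hW (f := fun p => g ((p.2.2 +ᵥ p.1, fieldMeasure ζ (p.2.2 +ᵥ p.1)),
        p.2.2 + p.2.1)) (by fun_prop)]
    exact hstat.lintegral_window_shift hζ hW hloc hC hb hfr
      (f := fun p => g ((p.1, fieldMeasure ζ p.1), p.2)) (by fun_prop)

end Stationary

/-! ### Specialisation to the pair of `X` and the density field -/

instance PathSpace.instMeasurableVAdd₂ {d : ℕ} (H : PathSpace d) :
    MeasurableVAdd₂ (Rd d) H.carrier :=
  ⟨H.measurable_shift⟩

instance Prod.instMeasurableVAdd₂ {M α β : Type*} [MeasurableSpace M] [MeasurableSpace α]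
    [MeasurableSpace β] [VAdd M α] [VAdd M β] [MeasurableVAdd₂ M α] [MeasurableVAdd₂ M β] :
    MeasurableVAdd₂ M (α × β) := by
  have h1 : Measurable fun p : M × α × β => p.1 +ᵥ p.2.1 := by fun_prop
  have h2 : Measurable fun p : M × α × β => p.1 +ᵥ p.2.2 := by fun_prop
  exact ⟨h1.prodMk h2⟩

theorem PathSpace.measurable_eval {d : ℕ} (H : PathSpace d) (s : Rd d) :
    Measurable fun z : H.carrier => z.1 s :=
  (measurable_pi_apply s).comp measurable_subtype_coe

theorem theorem4 {d : ℕ} {Ω E : Type*} [MeasurableSpace Ω] [MeasurableSpace E]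
    [AddAction (Rd d) E] [MeasurableVAdd₂ (Rd d) E] (H : PathSpace d)
    (P : Measure Ω) (X : Ω → E) (Z : Ω → H.carrier) (ξ : Ω → Measure (Rd d))
    (hX : Measurable X) (hξ : IsRandomMeasure ξ) (hZ : IsDensityField Z ξ)
    (hσ : SigmaFinite (P.map fun ω => ((X ω, Z ω), ξ ω)))
    (hstat : IsStationaryElement d P fun ω => (X ω, Z ω))
    (P₀ : Measure Ω) (hP₀ : P₀ = P.withDensity fun ω => ((Z ω).1 0 : ℝ≥0∞)) :
    IsPalmVersion P₀ (fun ω => (X ω, Z ω)) ξ P (fun ω => (X ω, Z ω)) ξ ∧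
      IsMassStationary P₀ (fun ω => (X ω, Z ω)) ξ := by
  subst hP₀
  let ζ : E × H.carrier → ℝ≥0∞ := fun y => (y.2.1 0 : ℝ≥0∞)
  have hζ : Measurable ζ := ((H.measurable_eval 0).comp measurable_snd).coe_nnreal_ennreal
  have hW : Measurable fun ω => (X ω, Z ω) := hX.prodMk hZ.measurable
  obtain rfl : ξ = fun ω => fieldMeasure ζ (X ω, Z ω) := by
    funext ω
    rw [hZ.eq_withDensity ω, fieldMeasure]
    congr 1
    funext s
    exact congrArg (fun r => ((Z ω).1 r : ℝ≥0∞)) (add_zero s).symm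
  have hζ' : ∀ y, ζ y ≠ ∞ := fun y => ENNReal.coe_ne_top
  have hpalm := hstat.isPalmVersion hζ hζ' hW hσ
  have hmass := hstat.isMassStationary hζ hζ' hW hξ.locallyFinite hσ
  exact ⟨hpalm, hmass⟩
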